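/- **Setting.** Fix a first-order alphabet of function and predicate symbols containing a unary predicate $\mathtt{error}$; equality $=$ is an additional built-in predicate. A *program* $P$ is a finite set of predicate definitions $(p(V_1,\dots,V_n),\ \exists W[C_1\lor\dots\lor C_k])$, $k>0$, at most one for each predicate $p\neq{=}$, where the $V_i$ are distinct variables, each $C_j$ is a conjunction of literals (atoms, including equations, or negated atoms), and $W$ is the set of the remaining (local) variables. The truth values are $\mathbf u=\emptyset$, $\mathbf t=\{\mathrm{true}\}$, $\mathbf f=\{\mathrm{false}\}$, $\mathbf i=\{\mathrm{true},\mathrm{false}\}$; the information order $\sqsubseteq$ is inclusion, with meet $\sqcap$. An interpretation $I$ maps each ground atom to a truth value, with $s=t$ mapped to $\mathbf t$ if $s,t$ are identical and to $\mathbf f$ otherwise. It makes an atom $A$ true (false) iff $\mathrm{true}\in I(A)$ ($\mathrm{false}\in I(A)$); negation swaps true and false; a conjunction is made true iff all its literals are, and false iff some literal is; a disjunction is made true iff some disjunct is, and false iff all are; $\exists W[D]$ is made true iff some ground instance of $D$ is, and false iff all ground instances are. $I(B)$ is the set of classical values that $I$ gives to $B$ in this way. $I$ is a $\sqsupseteq^{\mathbf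 4}$-*model* of $P$ if $I(B)\sqsubseteq I(H)$ for every instance $(H,B)$ of a definition of $P$ in which the head variables are replaced by ground terms. A ground atom *succeeds* if it has a successful SLDNF derivation from $P$ (for some selection of literals, negative literals being selected only when ground; a call to a predicate other than $=$ without a definition, such as the primitive $\mathtt{error}$, neither succeeds nor fails), or, in the idealised operational semantics, if it has the value $\mathbf t$ in the $\sqsubseteq$-least fixed point of the immediate consequence operator $\Phi_P$, where $\Phi_P(I)(H)=I(B)$ for each such instance $(H,B)$, and $\Phi_P(I)(H)=\mathbf u$ for atoms $H$ of predicates other than $=$ without a definition. Let any notion of well-typedness of the arguments of ground atoms be given. A *mode* $m$ of a predicate $p$ assigns "input" or "output" to each argument position of $p$. The mode interpretation for $m$ gives an atom $p(t_1,\dots,t_n)$ the value $\mathbf u$ if $p=\mathtt{error}$; otherwise $\mathbf t$ if all arguments are well typed, $\mathbf i$ if some input argument is ill typed, and $\mathbf f$ if all input arguments are well typed but some output argument is ill typed. A *moded program* is a program with a set of modes for each predicate other than $=$; its *mode interpretation* gives an atom of $p$ the meet $\sqcap$, over the modes $m$ of $p$, of its values in the mode interpretations for $m$. **Proposition.** Let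 $M$ be the mode interpretation of a moded program $P$, and suppose that $M$ is a $\sqsupseteq^{\mathbf 4}$-model of $P$. Let $A$ be a ground atom of a predicate other than $=$ which succeeds, and suppose that for some mode of its predicate all input arguments of $A$ are well typed. Then all arguments of $A$ are well typed. -/

import Mathlib

universe u v

noncomputable section

namespace LogicProg

/-! ### Syntax -/

/-- A predicate symbol (other than the built-in equality) together with its arity.  The alphabet is
a first-order language: its function symbols build the terms, its relation symbols are the
predicate symbols. -/
abbrev Pred (L : FirstOrder.Language.{u, v}) : Type v := Σ n : ℕ, L.Relations n

/-- Atoms `p(t₁, …, tₙ)` over the variables `α`, for a predicate `p` other than equality. -/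
structure PredAtom (L : FirstOrder.Language.{u, v}) (α : Type) where
  pred : Pred L
  args : Fin pred.1 → L.Term α

/-- Ground atoms `p(t₁, …, tₙ)`, for a predicate `p` other than equality. -/
abbrev GroundAtom (L : FirstOrder.Language.{u, v}) := PredAtom L Empty

/-- Atoms: either `p(t₁, …, tₙ)`, or an equality `s = t`. -/
inductive Atom (L : FirstOrder.Language.{u, v}) (α : Type) where
  | rel (A : PredAtom L α) : Atom L α
  | eq (s t : L.Term α) : Atom L α

/-- Literals: atoms and negated atoms. -/
inductive Literal (L : FirstOrder.Language.{u, v}) (α : Type) where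
  | pos (A : Atom L α) : Literal L α
  | neg (A : Atom L α) : Literal L α

/-- Conjunctions of literals (also used as goals). -/
abbrev Conj (L : FirstOrder.Language.{u, v}) (α : Type) := List (Literal L α)

section Substitution

variable {L : FirstOrder.Language.{u, v}} {α β : Type}

def PredAtom.subst (σ : α → L.Term β) (A : PredAtom L α) : PredAtom L β :=
  ⟨A.pred, fun i => (A.args i).subst σ⟩

def Atom.subst (σ : α → L.Term β) : Atom L α → Atom L β
  | .rel A => .rel (A.subst σ)
  | .eq s t => .eq (s.subst σ) (t.subst σ)

def Literal.subst (σ : α → L.Term β) : Literal L α → Literal L β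
  | .pos A => .pos (A.subst σ)
  | .neg A => .neg (A.subst σ)

def Conj.subst (σ : α → L.Term β) (C : Conj L α) : Conj L β :=
  C.map (Literal.subst σ)

end Substitution

/-- A predicate definition `(p(V₁, …, Vₙ), ∃ W [C₁ ∨ ⋯ ∨ Cₖ])` with `k > 0`.  The distinct head
variables are indexed by `Fin n` (left summand), the local variables `W` by `Fin locals` (right
summand); all variables of the body are of one of these two kinds. -/
structure PredDef (L : FirstOrder.Language.{u, v}) where
  pred : Pred L
  locals : ℕ
  disjuncts : List (Conj L (Fin pred.1 ⊕ Fin locals))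
  disjuncts_ne_nil : disjuncts ≠ []

/-- A program: a finite set of predicate definitions, at most one for each predicate. -/
structure Program (L : FirstOrder.Language.{u, v}) where
  defs : Set (PredDef L)
  finite_defs : defs.Finite
  unique_defs : ∀ d ∈ defs, ∀ d' ∈ defs, d.pred = d'.pred → d = d'

/-! ### Four-valued interpretations -/

/-- The four truth values, as sets of classical truth values.  The information ordering `⊑` is
inclusion, that is, `≤` on `Set Bool`, and its meet `⊓` is intersection. -/
abbrev Four := Set Bool

namespace Four

/-- undefined -/
def u : Four := ∅
/-- true -/
def t : Four := {true}
/-- false -/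
def f : Four := {false}
/-- inadmissible (both true and false) -/
def i : Four := {true, false}

/-- The truth value of a formula that is made true iff `T` and made false iff `F`. -/
def ofProps (T F : Prop) : Four := {b | (b = true ∧ T) ∨ (b = false ∧ F)}

end Four

/-- Four-valued interpretations, with the pointwise information ordering.  Only the values of the
atoms of predicates other than equality are recorded: those of ground equalities are fixed, see
`Interp.AtomTrue` and `Interp.AtomFalse`. -/
abbrev Interp (L : FirstOrder.Language.{u, v}) := GroundAtom L → Four

section Semantics

variable {L : FirstOrder.Language.{u, v}}

def Interp.AtomTrue (I : Interp L) : Atom L Empty → Prop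
  | .rel A => true ∈ I A
  | .eq s t => s = t

def Interp.AtomFalse (I : Interp L) : Atom L Empty → Prop
  | .rel A => false ∈ I A
  | .eq s t => s ≠ t

def Interp.MakesTrue (I : Interp L) : Literal L Empty → Prop
  | .pos A => I.AtomTrue A
  | .neg A => I.AtomFalse A

def Interp.MakesFalse (I : Interp L) : Literal L Empty → Prop
  | .pos A => I.AtomFalse A
  | .neg A => I.AtomTrue A

def Interp.ConjTrue (I : Interp L) (C : Conj L Empty) : Prop := ∀ l ∈ C, I.MakesTrue l

def Interp.ConjFalse (I : Interp L) (C : Conj L Empty) : Prop := ∃ l ∈ C, I.MakesFalse l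

/-- `I` makes true the body `∃ W [D]` of the head grounding of `d` with head `p(ts)`: some ground
instance of `D` is made true. -/
def Interp.BodyTrue (I : Interp L) (d : PredDef L) (ts : Fin d.pred.1 → L.Term Empty) : Prop :=
  ∃ w : Fin d.locals → L.Term Empty, ∃ C ∈ d.disjuncts, I.ConjTrue (C.subst (Sum.elim ts w))

/-- `I` makes false the body `∃ W [D]` of the head grounding of `d` with head `p(ts)`: all ground
instances of `D` are made false. -/
def Interp.BodyFalse (I : Interp L) (d : PredDef L) (ts : Fin d.pred.1 → L.Term Empty) : Prop :=
  ∀ w : Fin d.locals → L.Term Empty, ∀ C ∈ d.disjuncts, I.ConjFalse (C.subst (Sum.elim ts w))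

/-- The truth value in `I` of the body of the head grounding of `d` with head `p(ts)`. -/
def Interp.bodyValue (I : Interp L) (d : PredDef L) (ts : Fin d.pred.1 → L.Term Empty) : Four :=
  Four.ofProps (I.BodyTrue d ts) (I.BodyFalse d ts)

/-- `I` is an `R`-model of `P`: for each head grounding `(H, B)` of each predicate definition in
`P`, the relation `R (I H) (I B)` holds. -/
def IsModel (R : Four → Four → Prop) (P : Program L) (I : Interp L) : Prop :=
  ∀ d ∈ P.defs, ∀ ts : Fin d.pred.1 → L.Term Empty, R (I ⟨d.pred, ts⟩) (I.bodyValue d ts)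

theorem Interp.makesTrue_mono {I J : Interp L} (h : I ≤ J) :
    ∀ l : Literal L Empty, I.MakesTrue l → J.MakesTrue l
  | .pos (.rel A), hl => h A hl
  | .pos (.eq _ _), hl => hl
  | .neg (.rel A), hl => h A hl
  | .neg (.eq _ _), hl => hl

theorem Interp.makesFalse_mono {I J : Interp L} (h : I ≤ J) :
    ∀ l : Literal L Empty, I.MakesFalse l → J.MakesFalse l
  | .pos (.rel A), hl => h A hl
  | .pos (.eq _ _), hl => hl
  | .neg (.rel A), hl => h A hl
  | .neg (.eq _ _), hl => hl

theorem Interp.bodyValue_mono {I J : Interp L} (h : I ≤ J) (d : PredDef L)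
    (ts : Fin d.pred.1 → L.Term Empty) : I.bodyValue d ts ≤ J.bodyValue d ts := by
  rintro b (⟨rfl, w, C, hC, hT⟩ | ⟨rfl, hF⟩)
  · exact Or.inl ⟨rfl, w, C, hC, fun l hl => Interp.makesTrue_mono h l (hT l hl)⟩
  · refine Or.inr ⟨rfl, fun w C hC => ?_⟩
    obtain ⟨l, hl, hlF⟩ := hF w C hC
    exact ⟨l, hl, Interp.makesFalse_mono h l hlF⟩

/-- The immediate consequence operator `Φ_P`: the new value of a ground atom `H` is the old value
of `B`, where `(H, B)` is the head grounding of a definition in `P`.  Atoms of predicates without a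
definition (such as the primitive `error/1`) become neither true nor false. -/
def Program.phi (P : Program L) : Interp L →o Interp L where
  toFun I A := {b | ∃ d ∈ P.defs, ∃ ts : Fin d.pred.1 → L.Term Empty,
    A = ⟨d.pred, ts⟩ ∧ b ∈ I.bodyValue d ts}
  monotone' := by
    rintro I J h A b ⟨d, hd, ts, hA, hb⟩
    exact ⟨d, hd, ts, hA, Interp.bodyValue_mono h d ts hb⟩

end Semantics

/-! ### SLDNF resolution -/

section SLDNF

variable {L : FirstOrder.Language.{u, v}}

def Atom.vars : Atom L ℕ → Set ℕ
  | .rel A => {x | ∃ i, x ∈ (A.args i).varFinset}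
  | .eq s t => {x | x ∈ s.varFinset ∨ x ∈ t.varFinset}

def Literal.vars : Literal L ℕ → Set ℕ
  | .pos A => A.vars
  | .neg A => A.vars

/-- The set of variables that occur in a goal. -/
def Conj.vars (G : Conj L ℕ) : Set ℕ := {x | ∃ l ∈ G, x ∈ l.vars}

/-- `σ` is a most general unifier of `s` and `t`. -/
def IsMGU (σ : ℕ → L.Term ℕ) (s t : L.Term ℕ) : Prop :=
  s.subst σ = t.subst σ ∧
    ∀ τ : ℕ → L.Term ℕ, s.subst τ = t.subst τ → ∃ δ : ℕ → L.Term ℕ, ∀ x, τ x = (σ x).subst δ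

/-- A ground atom, seen as an atom that may contain variables. -/
def Atom.ofGround (A : Atom L Empty) : Atom L ℕ := A.subst Empty.elim

/-- Given terms `ts` for the head variables and names `ρ` for the local variables, the
corresponding instance of a disjunct of a definition. -/
def PredDef.resolvent {d : PredDef L} (ts : Fin d.pred.1 → L.Term ℕ) (ρ : Fin d.locals → ℕ)
    (C : Conj L (Fin d.pred.1 ⊕ Fin d.locals)) : Conj L ℕ :=
  C.subst (Sum.elim ts fun j => FirstOrder.Language.Term.var (ρ j))

mutual

/-- The goal `G` has a successful SLDNF derivation from `P`, for some choice of the selected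
literals.  Negative literals are selected only when they are ground. -/
inductive Program.GoalSucceeds (P : Program L) : Conj L ℕ → Prop
  | nil : P.GoalSucceeds []
  /-- A selected atom is replaced by a disjunct of (a fresh variant of) its definition. -/
  | rel (G₁ G₂ : Conj L ℕ) (d : PredDef L) (hd : d ∈ P.defs) (ts : Fin d.pred.1 → L.Term ℕ)
      (ρ : Fin d.locals → ℕ) (hρ : Function.Injective ρ)
      (hfresh : ∀ j, ρ j ∉ Conj.vars (G₁ ++ .pos (.rel ⟨d.pred, ts⟩) :: G₂))
      (C : Conj L (Fin d.pred.1 ⊕ Fin d.locals)) (hC : C ∈ d.disjuncts)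
      (h : P.GoalSucceeds (G₁ ++ PredDef.resolvent ts ρ C ++ G₂)) :
      P.GoalSucceeds (G₁ ++ .pos (.rel ⟨d.pred, ts⟩) :: G₂)
  /-- A selected equation is solved by unification. -/
  | eq (G₁ G₂ : Conj L ℕ) (s t : L.Term ℕ) (σ : ℕ → L.Term ℕ) (hσ : IsMGU σ s t)
      (h : P.GoalSucceeds (Conj.subst σ (G₁ ++ G₂))) :
      P.GoalSucceeds (G₁ ++ .pos (.eq s t) :: G₂)
  /-- A selected ground negative literal succeeds if its atom finitely fails. -/
  | neg (G₁ G₂ : Conj L ℕ) (A : Atom L Empty) (hA : P.GoalFails [.pos A.ofGround])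
      (h : P.GoalSucceeds (G₁ ++ G₂)) :
      P.GoalSucceeds (G₁ ++ .neg A.ofGround :: G₂)

/-- The goal `G` has a finitely failed SLDNF tree from `P`, for some choice of the selected
literals.  A call to a predicate without a definition (such as the primitive `error/1`) is an
error, hence neither success nor failure. -/
inductive Program.GoalFails (P : Program L) : Conj L ℕ → Prop
  | rel (G₁ G₂ : Conj L ℕ) (d : PredDef L) (hd : d ∈ P.defs) (ts : Fin d.pred.1 → L.Term ℕ)
      (ρ : Fin d.locals → ℕ) (hρ : Function.Injective ρ)
      (hfresh : ∀ j, ρ j ∉ Conj.vars (G₁ ++ .pos (.rel ⟨d.pred, ts⟩) :: G₂))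
      (h : ∀ C ∈ d.disjuncts, P.GoalFails (G₁ ++ PredDef.resolvent ts ρ C ++ G₂)) :
      P.GoalFails (G₁ ++ .pos (.rel ⟨d.pred, ts⟩) :: G₂)
  | eq (G₁ G₂ : Conj L ℕ) (s t : L.Term ℕ) (σ : ℕ → L.Term ℕ) (hσ : IsMGU σ s t)
      (h : P.GoalFails (Conj.subst σ (G₁ ++ G₂))) :
      P.GoalFails (G₁ ++ .pos (.eq s t) :: G₂)
  | eq_not_unifiable (G₁ G₂ : Conj L ℕ) (s t : L.Term ℕ)
      (h : ∀ σ : ℕ → L.Term ℕ, s.subst σ ≠ t.subst σ) :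
      P.GoalFails (G₁ ++ .pos (.eq s t) :: G₂)
  | neg (G₁ G₂ : Conj L ℕ) (A : Atom L Empty) (hA : P.GoalFails [.pos A.ofGround])
      (h : P.GoalFails (G₁ ++ G₂)) :
      P.GoalFails (G₁ ++ .neg A.ofGround :: G₂)
  | neg_of_succeeds (G₁ G₂ : Conj L ℕ) (A : Atom L Empty)
      (hA : P.GoalSucceeds [.pos A.ofGround]) :
      P.GoalFails (G₁ ++ .neg A.ofGround :: G₂)

end

/-- The ground atom `A` succeeds: it has a successful SLDNF derivation. -/
def Program.Succeeds (P : Program L) (A : GroundAtom L) : Prop :=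
  P.GoalSucceeds [.pos (Atom.ofGround (.rel A))]

/-- The ground atom `A` succeeds in the idealised operational semantics, in which the atoms that
succeed are those that have the value `t` in the least fixed point of `Φ_P`. -/
def Program.IdeallySucceeds (P : Program L) (A : GroundAtom L) : Prop :=
  OrderHom.lfp P.phi A = Four.t

end SLDNF

/-! ### Types and modes -/

inductive Direction where
  | input
  | output

/-- A mode for `p`: each argument position is an input or an output. -/
abbrev Mode {L : FirstOrder.Language.{u, v}} (p : Pred L) := Fin p.1 → Direction

/-- A notion of well-typedness: `T p ts i` says that the `i`-th argument of the ground atom `p(ts)`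
is well typed.  (It may, but need not, depend on the other arguments.) -/
abbrev Typing (L : FirstOrder.Language.{u, v}) :=
  ∀ p : Pred L, (Fin p.1 → L.Term Empty) → Fin p.1 → Prop

/-- A moded program: a program with a mode group, that is, a set of modes, for each predicate. -/
structure ModedProgram (L : FirstOrder.Language.{u, v}) where
  program : Program L
  modes : ∀ p : Pred L, Set (Mode p)

section Modes

variable {L : FirstOrder.Language.{u, v}}

open Classical in
/-- The value of the ground atom `p(ts)` in the mode interpretation for the single mode `m` of `p`,
where `error` is the predicate `error/1`. -/
def modeValue (error : L.Relations 1) (T : Typing L) (p : Pred L) (m : Mode p)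
    (ts : Fin p.1 → L.Term Empty) : Four :=
  if p = ⟨1, error⟩ then Four.u
  else if ∀ i, T p ts i then Four.t
  else if ∃ i, m i = Direction.input ∧ ¬ T p ts i then Four.i
  else Four.f

/-- The mode interpretation of a moded program: on the atoms of each predicate, the meet in the
information ordering of the mode interpretations for the modes in its mode group. -/
def ModedProgram.modeInterp (Q : ModedProgram L) (error : L.Relations 1) (T : Typing L) :
    Interp L :=
  fun A => ⨅ m ∈ Q.modes A.pred, modeValue error T A.pred m A.args

end Modes

end LogicProg

end

-- SLDNF resolution is sound for every four-valued model `I` of the program: if a goal succeeds, `I`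
-- makes some ground instance of it true; if it finitely fails, `I` makes every ground instance
-- false. Both claims go by simultaneous induction on derivations (`IsModel.someInstanceTrue`,
-- `IsModel.allInstancesFalse`). Truth and falsity are tracked separately, so `I` need not be
-- consistent. In the idealised semantics `IsModel.lfp_le` plays the same role.
--
-- Hence the mode interpretation makes a succeeding atom true. Being a meet, it lies below the value
-- for the mode whose inputs are well typed, so that value contains true. Well-typed inputs rule out
-- `i`, and `u` and `f` do not contain true, so all arguments are well typed.

namespace LogicProg

section Soundness

variable {L : FirstOrder.Language.{u, v}}

-- Substitution calculus

theorem term_subst_subst {α β γ : Type} (t : L.Term α) (σ : α → L.Term β) (τ : β → L.Term γ) :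
    (t.subst σ).subst τ = t.subst fun x => (σ x).subst τ := by
  induction t with
  | var x => rfl
  | func f ts ih => simp only [FirstOrder.Language.Term.subst, ih]

theorem term_subst_congr {α β : Type} [DecidableEq α] {σ τ : α → L.Term β} (t : L.Term α)
    (h : ∀ x ∈ t.varFinset, σ x = τ x) : t.subst σ = t.subst τ := by
  induction t with
  | var x => exact h x (by simp [FirstOrder.Language.Term.varFinset])
  | func f ts ih =>
    simp only [FirstOrder.Language.Term.subst]
    congr 1
    funext i
    refine ih i fun x hx => h x ?_
    simp only [FirstOrder.Language.Term.varFinset, Finset.mem_biUnion, Finset.mem_univ, true_and]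
    exact ⟨i, hx⟩

theorem term_subst_var {α : Type} (t : L.Term α) : t.subst FirstOrder.Language.Term.var = t := by
  induction t with
  | var x => rfl
  | func f ts ih => simp only [FirstOrder.Language.Term.subst, ih]

/-- Substituting in a ground term, seen as a term with variables, gives back the ground term. -/
theorem term_ground_subst {α : Type} (t : L.Term Empty) (σ : α → L.Term Empty) :
    (t.subst (Empty.elim : Empty → L.Term α)).subst σ = t := by
  rw [term_subst_subst]
  convert term_subst_var t using 2

theorem Atom.subst_subst {α β γ : Type} (A : Atom L α) (σ : α → L.Term β) (τ : β → L.Term γ) :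
    (A.subst σ).subst τ = A.subst fun x => (σ x).subst τ := by
  cases A <;> simp only [Atom.subst, PredAtom.subst, term_subst_subst]

theorem Literal.subst_subst {α β γ : Type} (l : Literal L α) (σ : α → L.Term β)
    (τ : β → L.Term γ) : (l.subst σ).subst τ = l.subst fun x => (σ x).subst τ := by
  cases l <;> simp only [Literal.subst, Atom.subst_subst]

theorem Conj.subst_subst {α β γ : Type} (C : Conj L α) (σ : α → L.Term β) (τ : β → L.Term γ) :
    Conj.subst τ (Conj.subst σ C) = Conj.subst (fun x => (σ x).subst τ) C := by
  simp only [Conj.subst, List.map_map]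
  exact List.map_congr_left fun l _ => Literal.subst_subst l σ τ

theorem Atom.ofGround_subst (A : Atom L Empty) (σ : ℕ → L.Term Empty) :
    A.ofGround.subst σ = A := by
  cases A <;> simp only [Atom.ofGround, Atom.subst, PredAtom.subst, term_ground_subst]

theorem Atom.subst_congr {β : Type} {σ τ : ℕ → L.Term β} (A : Atom L ℕ)
    (h : ∀ x ∈ A.vars, σ x = τ x) : A.subst σ = A.subst τ := by
  cases A with
  | rel A =>
    simp only [Atom.subst, PredAtom.subst]
    congr 2
    funext i
    exact term_subst_congr _ fun x hx => h x ⟨i, hx⟩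
  | eq s t =>
    simp only [Atom.subst]
    rw [term_subst_congr s fun x hx => h x (Or.inl hx),
      term_subst_congr t fun x hx => h x (Or.inr hx)]

theorem Literal.subst_congr {β : Type} {σ τ : ℕ → L.Term β} (l : Literal L ℕ)
    (h : ∀ x ∈ l.vars, σ x = τ x) : l.subst σ = l.subst τ := by
  cases l <;> simp only [Literal.subst] <;> rw [Atom.subst_congr _ h]

-- Soundness of single resolution steps

/-- The conclusion of soundness for successful goals: some ground instance is made true. -/
def Interp.SomeInstanceTrue (I : Interp L) (G : Conj L ℕ) : Prop :=
  ∃ σ : ℕ → L.Term Empty, ∀ l ∈ G, I.MakesTrue (l.subst σ)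

/-- The conclusion of soundness for failed goals: every ground instance is made false. -/
def Interp.AllInstancesFalse (I : Interp L) (G : Conj L ℕ) : Prop :=
  ∀ σ : ℕ → L.Term Empty, ∃ l ∈ G, I.MakesFalse (l.subst σ)

theorem PredDef.resolvent_subst {d : PredDef L} (ts : Fin d.pred.1 → L.Term ℕ)
    (ρ : Fin d.locals → ℕ) (C : Conj L (Fin d.pred.1 ⊕ Fin d.locals)) (σ : ℕ → L.Term Empty) :
    Conj.subst σ (PredDef.resolvent ts ρ C) =
      C.subst (Sum.elim (fun i => (ts i).subst σ) fun j => σ (ρ j)) := by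
  rw [PredDef.resolvent, Conj.subst_subst]
  congr 1
  funext x
  cases x <;> rfl

variable {P : Program L} {I : Interp L}

theorem IsModel.true_mem (hI : IsModel (fun a b => a ≥ b) P I) {d : PredDef L} (hd : d ∈ P.defs)
    {ts : Fin d.pred.1 → L.Term Empty} (h : I.BodyTrue d ts) : true ∈ I ⟨d.pred, ts⟩ :=
  hI d hd ts (Or.inl ⟨rfl, h⟩)

theorem IsModel.false_mem (hI : IsModel (fun a b => a ≥ b) P I) {d : PredDef L} (hd : d ∈ P.defs)
    {ts : Fin d.pred.1 → L.Term Empty} (h : I.BodyFalse d ts) : false ∈ I ⟨d.pred, ts⟩ :=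
  hI d hd ts (Or.inr ⟨rfl, h⟩)

/-- The grounding of the resolvent also supplies the existential witnesses for the local variables,
so no freshness is needed. -/
theorem IsModel.someInstanceTrue_rel (hI : IsModel (fun a b => a ≥ b) P I) (G₁ G₂ : Conj L ℕ)
    {d : PredDef L} (hd : d ∈ P.defs) (ts : Fin d.pred.1 → L.Term ℕ) (ρ : Fin d.locals → ℕ)
    {C : Conj L (Fin d.pred.1 ⊕ Fin d.locals)} (hC : C ∈ d.disjuncts)
    (h : I.SomeInstanceTrue (G₁ ++ PredDef.resolvent ts ρ C ++ G₂)) :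
    I.SomeInstanceTrue (G₁ ++ .pos (.rel ⟨d.pred, ts⟩) :: G₂) := by
  obtain ⟨σ, hσ⟩ := h
  refine ⟨σ, fun l hl => ?_⟩
  rcases List.mem_append.1 hl with hl | hl
  · exact hσ l (by simp [hl])
  rcases List.mem_cons.1 hl with rfl | hl
  · refine hI.true_mem hd ⟨fun j => σ (ρ j), C, hC, ?_⟩
    rw [← PredDef.resolvent_subst]
    intro l hl
    obtain ⟨l', hl', rfl⟩ := List.mem_map.1 hl
    exact hσ l' (by simp [hl'])
  · exact hσ l (by simp [hl])

/-- Falsity of the body quantifies over all values of the local variables. Freshness and injectivity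
of `ρ` allow these values to be prescribed without disturbing the rest of the goal. -/
theorem IsModel.allInstancesFalse_rel (hI : IsModel (fun a b => a ≥ b) P I) (G₁ G₂ : Conj L ℕ)
    {d : PredDef L} (hd : d ∈ P.defs) (ts : Fin d.pred.1 → L.Term ℕ) (ρ : Fin d.locals → ℕ)
    (hρ : Function.Injective ρ)
    (hfresh : ∀ j, ρ j ∉ Conj.vars (G₁ ++ .pos (.rel ⟨d.pred, ts⟩) :: G₂))
    (h : ∀ C ∈ d.disjuncts, I.AllInstancesFalse (G₁ ++ PredDef.resolvent ts ρ C ++ G₂)) :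
    I.AllInstancesFalse (G₁ ++ .pos (.rel ⟨d.pred, ts⟩) :: G₂) := by
  intro σ
  by_contra hno
  push Not at hno
  -- If no literal of the goal is false under `σ`, the selected atom is not false; the contradiction
  -- comes from proving its body false.
  refine hno (.pos (.rel ⟨d.pred, ts⟩)) (by simp) (hI.false_mem hd fun w C hC => ?_)
  -- `τ` takes the values `w` on the renamed local variables and agrees with `σ` on the goal.
  set τ : ℕ → L.Term Empty := Function.extend ρ w σ with hτ
  have agree : ∀ x ∈ Conj.vars (G₁ ++ .pos (.rel ⟨d.pred, ts⟩) :: G₂), τ x = σ x := by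
    intro x hx
    refine Function.extend_apply' _ _ _ ?_
    rintro ⟨j, rfl⟩
    exact hfresh j hx
  have hlocal : (fun j => τ (ρ j)) = w := funext fun j => hρ.extend_apply _ _ _
  have hhead : (fun i => (ts i).subst τ) = fun i => (ts i).subst σ := funext fun i =>
    term_subst_congr _ fun x hx =>
      agree x ⟨.pos (.rel ⟨d.pred, ts⟩), by simp, i, hx⟩
  have hrest : ∀ l ∈ G₁ ++ .pos (.rel ⟨d.pred, ts⟩) :: G₂, l.subst τ = l.subst σ :=
    fun l hl => Literal.subst_congr l fun x hx => agree x ⟨l, hl, hx⟩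
  have hres := PredDef.resolvent_subst ts ρ C τ
  rw [hlocal, hhead] at hres
  obtain ⟨l, hl, hlF⟩ := h C hC τ
  change ∃ l ∈ C.subst (Sum.elim (fun i => (ts i).subst σ) w), I.MakesFalse l
  rw [← hres]
  rw [List.mem_append, List.mem_append] at hl
  rcases hl with (hl | hl) | hl
  -- A false literal outside the resolvent would already be false under `σ`.
  · have hm : l ∈ G₁ ++ .pos (.rel ⟨d.pred, ts⟩) :: G₂ := by simp [hl]
    exact absurd (hrest l hm ▸ hlF) (hno l hm)
  · exact ⟨_, List.mem_map_of_mem hl, hlF⟩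
  · have hm : l ∈ G₁ ++ .pos (.rel ⟨d.pred, ts⟩) :: G₂ := by simp [hl]
    exact absurd (hrest l hm ▸ hlF) (hno l hm)

theorem Interp.someInstanceTrue_eq (G₁ G₂ : Conj L ℕ) {s t : L.Term ℕ} {σ : ℕ → L.Term ℕ}
    (hσ : s.subst σ = t.subst σ) (h : I.SomeInstanceTrue (Conj.subst σ (G₁ ++ G₂))) :
    I.SomeInstanceTrue (G₁ ++ .pos (.eq s t) :: G₂) := by
  obtain ⟨τ, hτ⟩ := h
  have hrest : ∀ l ∈ G₁ ++ G₂, I.MakesTrue (l.subst fun x => (σ x).subst τ) := fun l hl => by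
    rw [← Literal.subst_subst]
    exact hτ _ (List.mem_map_of_mem hl)
  refine ⟨fun x => (σ x).subst τ, fun l hl => ?_⟩
  rcases List.mem_append.1 hl with hl | hl
  · exact hrest l (by simp [hl])
  rcases List.mem_cons.1 hl with rfl | hl
  · change s.subst _ = t.subst _
    rw [← term_subst_subst, ← term_subst_subst, hσ]
  · exact hrest l (by simp [hl])

/-- A ground unifier lifts to a unifier over terms with variables. -/
theorem subst_ground_lift {s t : L.Term ℕ} {τ : ℕ → L.Term Empty} (h : s.subst τ = t.subst τ) :
    s.subst (fun x => (τ x).subst (Empty.elim : Empty → L.Term ℕ)) =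
      t.subst fun x => (τ x).subst Empty.elim := by
  rw [← term_subst_subst, ← term_subst_subst, h]

/-- A grounding that does not unify `s` and `t` falsifies the equation; one that does factors
through the most general unifier. -/
theorem Interp.allInstancesFalse_eq [Nonempty (L.Term Empty)] (G₁ G₂ : Conj L ℕ) {s t : L.Term ℕ}
    {σ : ℕ → L.Term ℕ} (hσ : IsMGU σ s t) (h : I.AllInstancesFalse (Conj.subst σ (G₁ ++ G₂))) :
    I.AllInstancesFalse (G₁ ++ .pos (.eq s t) :: G₂) := by
  intro τ
  by_cases hst : s.subst τ = t.subst τ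
  · obtain ⟨δ, hδ⟩ := hσ.2 _ (subst_ground_lift hst)
    -- The factor `δ` may introduce variables; any grounding of them works, since `τ` is already
    -- ground.
    let c : ℕ → L.Term Empty := fun _ => Classical.arbitrary _
    have hτ : τ = fun x => (σ x).subst fun y => (δ y).subst c := funext fun x => by
      rw [← term_subst_subst, ← hδ x, term_ground_subst]
    obtain ⟨l, hl, hlF⟩ := h fun y => (δ y).subst c
    obtain ⟨l', hl', rfl⟩ := List.mem_map.1 hl
    rw [Literal.subst_subst, ← hτ] at hlF
    refine ⟨l', ?_, hlF⟩
    rw [List.mem_append] at hl' ⊢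
    exact hl'.imp_right (List.mem_cons_of_mem _)
  · exact ⟨.pos (.eq s t), by simp, hst⟩

theorem Interp.allInstancesFalse_eq_not_unifiable (G₁ G₂ : Conj L ℕ) {s t : L.Term ℕ}
    (h : ∀ σ : ℕ → L.Term ℕ, s.subst σ ≠ t.subst σ) :
    I.AllInstancesFalse (G₁ ++ .pos (.eq s t) :: G₂) :=
  fun _ => ⟨.pos (.eq s t), by simp, fun hst => h _ (subst_ground_lift hst)⟩

theorem Interp.SomeInstanceTrue.atomTrue {A : Atom L Empty}
    (h : I.SomeInstanceTrue [.pos A.ofGround]) : I.AtomTrue A := by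
  obtain ⟨σ, hσ⟩ := h
  have hA : I.AtomTrue (A.ofGround.subst σ) := hσ _ (List.mem_singleton_self _)
  rwa [Atom.ofGround_subst] at hA

theorem Interp.AllInstancesFalse.atomFalse [Nonempty (L.Term Empty)] {A : Atom L Empty}
    (h : I.AllInstancesFalse [.pos A.ofGround]) : I.AtomFalse A := by
  obtain ⟨l, hl, hlF⟩ := h fun _ => Classical.arbitrary _
  obtain rfl := List.mem_singleton.1 hl
  change I.AtomFalse (A.ofGround.subst _) at hlF
  rwa [Atom.ofGround_subst] at hlF

theorem Interp.someInstanceTrue_neg (G₁ G₂ : Conj L ℕ) {A : Atom L Empty} (hA : I.AtomFalse A)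
    (h : I.SomeInstanceTrue (G₁ ++ G₂)) :
    I.SomeInstanceTrue (G₁ ++ .neg A.ofGround :: G₂) := by
  obtain ⟨σ, hσ⟩ := h
  refine ⟨σ, fun l hl => ?_⟩
  rcases List.mem_append.1 hl with hl | hl
  · exact hσ l (by simp [hl])
  rcases List.mem_cons.1 hl with rfl | hl
  · change I.AtomFalse (A.ofGround.subst σ)
    rwa [Atom.ofGround_subst]
  · exact hσ l (by simp [hl])

theorem Interp.AllInstancesFalse.insert {G₁ G₂ : Conj L ℕ} (h : I.AllInstancesFalse (G₁ ++ G₂))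
    (l : Literal L ℕ) : I.AllInstancesFalse (G₁ ++ l :: G₂) := by
  intro σ
  obtain ⟨l', hl', hF⟩ := h σ
  refine ⟨l', ?_, hF⟩
  rw [List.mem_append] at hl' ⊢
  exact hl'.imp_right (List.mem_cons_of_mem _)

theorem Interp.allInstancesFalse_neg (G₁ G₂ : Conj L ℕ) {A : Atom L Empty} (hA : I.AtomTrue A) :
    I.AllInstancesFalse (G₁ ++ .neg A.ofGround :: G₂) := by
  refine fun σ => ⟨.neg A.ofGround, by simp, ?_⟩
  change I.AtomTrue (A.ofGround.subst σ)
  rwa [Atom.ofGround_subst]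

-- Soundness of whole derivations

mutual

/-- Soundness of SLDNF resolution for success, with respect to an arbitrary model. -/
theorem IsModel.someInstanceTrue [Nonempty (L.Term Empty)]
    (hI : IsModel (fun a b => a ≥ b) P I) {G : Conj L ℕ} :
    P.GoalSucceeds G → I.SomeInstanceTrue G
  | .nil => ⟨fun _ => Classical.arbitrary _, fun _ hl => absurd hl List.not_mem_nil⟩
  | .rel G₁ G₂ _ hd ts ρ _ _ _ hC h =>
    hI.someInstanceTrue_rel G₁ G₂ hd ts ρ hC (hI.someInstanceTrue h)
  | .eq G₁ G₂ _ _ _ hσ h => Interp.someInstanceTrue_eq G₁ G₂ hσ.1 (hI.someInstanceTrue h)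
  | .neg G₁ G₂ _ hA h =>
    Interp.someInstanceTrue_neg G₁ G₂ (hI.allInstancesFalse hA).atomFalse (hI.someInstanceTrue h)

/-- Soundness of SLDNF resolution for finite failure, with respect to an arbitrary model. -/
theorem IsModel.allInstancesFalse [Nonempty (L.Term Empty)]
    (hI : IsModel (fun a b => a ≥ b) P I) {G : Conj L ℕ} :
    P.GoalFails G → I.AllInstancesFalse G
  | .rel G₁ G₂ _ hd ts ρ hρ hfresh h =>
    hI.allInstancesFalse_rel G₁ G₂ hd ts ρ hρ hfresh fun C hC => hI.allInstancesFalse (h C hC)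
  | .eq G₁ G₂ _ _ _ hσ h => Interp.allInstancesFalse_eq G₁ G₂ hσ (hI.allInstancesFalse h)
  | .eq_not_unifiable G₁ G₂ _ _ h => Interp.allInstancesFalse_eq_not_unifiable G₁ G₂ h
  | .neg _ _ _ _ h => (hI.allInstancesFalse h).insert _
  | .neg_of_succeeds G₁ G₂ _ hA =>
    Interp.allInstancesFalse_neg G₁ G₂ (hI.someInstanceTrue hA).atomTrue

end

theorem IsModel.true_mem_of_succeeds [Nonempty (L.Term Empty)]
    (hI : IsModel (fun a b => a ≥ b) P I) {A : GroundAtom L} (hA : P.Succeeds A) : true ∈ I A :=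
  (hI.someInstanceTrue hA).atomTrue

/-- A model is exactly a pre-fixed point of `Φ_P`: atoms without a definition get the value `u`,
which imposes no constraint. -/
theorem IsModel.lfp_le (hI : IsModel (fun a b => a ≥ b) P I) : OrderHom.lfp P.phi ≤ I := by
  refine OrderHom.lfp_le _ ?_
  rintro _ b ⟨d, hd, ts, rfl, hb⟩
  exact hI d hd ts hb

theorem IsModel.true_mem_of_ideallySucceeds (hI : IsModel (fun a b => a ≥ b) P I)
    {A : GroundAtom L} (hA : P.IdeallySucceeds A) : true ∈ I A := by
  refine hI.lfp_le A ?_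
  rw [show OrderHom.lfp P.phi A = Four.t from hA]
  exact Set.mem_singleton _

-- Modes and the conclusion

theorem forall_wellTyped_of_true_mem_modeValue {error : L.Relations 1} {T : Typing L} {p : Pred L}
    {m : Mode p} {ts : Fin p.1 → L.Term Empty} (h : true ∈ modeValue error T p m ts)
    (hin : ∀ i, m i = Direction.input → T p ts i) : ∀ i, T p ts i := by
  by_contra hT
  have hno : ¬ ∃ i, m i = Direction.input ∧ ¬ T p ts i := fun ⟨i, hi, hTi⟩ => hTi (hin i hi)
  rw [modeValue, if_neg hT, if_neg hno] at h
  split_ifs at h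
  · exact h
  · exact Bool.noConfusion (Set.mem_singleton_iff.1 h)

end Soundness

end LogicProg

theorem mainTheorem7 {L : FirstOrder.Language.{u, v}} (error : L.Relations 1)
    (T : LogicProg.Typing L) (Q : LogicProg.ModedProgram L)
    (hM : LogicProg.IsModel (fun a b => a ≥ b) Q.program (Q.modeInterp error T))
    (A : LogicProg.GroundAtom L)
    (hA : Q.program.Succeeds A ∨ Q.program.IdeallySucceeds A)
    (hin : ∃ m ∈ Q.modes A.pred,
      ∀ i, m i = LogicProg.Direction.input → T A.pred A.args i) :
    ∀ i, T A.pred A.args i := by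
  intro i
  -- Soundness needs a ground term; if there is an argument to check, it is one.
  have : Nonempty (L.Term Empty) := ⟨A.args i⟩
  obtain ⟨m, hm, hin⟩ := hin
  have htrue : true ∈ Q.modeInterp error T A :=
    hA.elim hM.true_mem_of_succeeds hM.true_mem_of_ideallySucceeds
  have hle : Q.modeInterp error T A ≤ LogicProg.modeValue error T A.pred m A.args :=
    iInf₂_le m hm
  exact LogicProg.forall_wellTyped_of_true_mem_modeValue (hle htrue) hin i
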